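/- A digraph $G$ has a finite non-empty vertex set $V(G)$ and an arc set $A(G)\subseteq V(G)\times V(G)$ (loops allowed); an arc $vw$ is proper if $v\neq w$, and $G^*$ is $G$ with all loops removed. A poset is a reflexive, antisymmetric, transitive digraph; $\mathfrak P$ is the class of posets, and $\mathfrak T_a$ is the class of digraphs $G$ such that $G^*$ contains no closed directed walk of length $\ge 1$. $\mathcal H(G,H)$ is the set of homomorphisms $V(G)\to V(H)$ (maps sending arcs to arcs), and $\mathcal S(G,H)\subseteq\mathcal H(G,H)$ is the set of strict ones, which send proper arcs to proper arcs. For a class $\mathfrak D'$ of digraphs, $R\sqsubseteq_{\mathcal H}S$ with domain $\mathfrak D'$ means $\#\mathcal H(G,R)\le\#\mathcal H(G,S)$ for all $G\in\mathfrak D'$, and $R\sqsubseteq_{\mathcal S}S$ with domain $\mathfrak D'$ means $\#\mathcal S(G,R)\le\#\mathcal S(G,S)$ for all $G\in\mathfrak D'$. A path of length $\ell$ is a directed walk $v_0,\dots,v_\ell$ with distinct vertices; the height $h_G$ is the largest length of a path in $G$. For $n\in\mathbb N_0$, let $\mathfrak T_a^{n}$ be the class of $G\in\mathfrak T_a$ with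 $h_G=n$ in which every vertex belongs to a path of length $n$. For the vertex set $P$ of a path in $G\in\mathfrak T_a$, let $P_\times$ be the transitive reduction, without loops, of the digraph induced by $G$ on $P$; that is, $V(P_\times)=P$ and $A(P_\times)$ consists of the proper arcs $vw$ of $G$ with $v,w\in P$ for which there is no directed walk of length $\ge2$ from $v$ to $w$ in $G^*$ with all vertices in $P$. For an arc $vw$ of $H$ let $\iota(v,w)_H=\#\{x\in V(H): vx\in A(H),\ xw\in A(H)\}$, and for $\xi\in\mathcal H(L,H)$ let $\mu_\xi(L)=\sum_{vw\in A(L^*)}\iota(\xi(v),\xi(w))_H$. Let $\mathfrak R$ be the class of reflexive digraphs $R\in\mathfrak T_a$ for which there exists $\rho\in\mathcal S(R,R)$ such that, for every path of length $h_R$ in $R$ with vertex set $P$, $\mu_{\rho|_P}(P_\times)=\max\{\mu_\xi(P_\times):\xi\in\mathcal H(P_\times,R)\}$. **Theorem.** (a) Let $R,S\in\mathfrak R$ with $h_R=h_S=n\ge1$. Then $R\sqsubseteq_{\mathcal H}S$ with domain $\mathfrak T_a$ implies $$\#\mathcal S(G,R)\le\#\mathcal S(G,S)\quad\text{for all }G\in\mathfrak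 T_a^{n}\text{ with }\mathcal S(G,S)\neq\emptyset,$$ and $R\sqsubseteq_{\mathcal H}S$ with domain $\mathfrak P$ implies $$\#\mathcal S(G,R)\le\#\mathcal S(G,S)\quad\text{for all }G\in\mathfrak T_a^{n}\cap\mathfrak P.$$ (b) Let $R,S\in\mathfrak P$ with $h_R=h_S\le1$. Then $$R\sqsubseteq_{\mathcal H}S\iff R\sqsubseteq_{\mathcal S}S,$$ where both relations are taken with domain $\mathfrak T_a$, or both with domain $\mathfrak P$. -/

import Mathlib

universe u

namespace HomCount

/-- The set `H(G, H)` of homomorphisms: vertex maps sending arcs to arcs. -/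
def homs {V W : Type u} (G : Digraph V) (H : Digraph W) : Set (V → W) :=
  {ξ | ∀ v w, G.Adj v w → H.Adj (ξ v) (ξ w)}

/-- `G*`, the digraph `G` with its loops removed. -/
def loopless {V : Type u} (G : Digraph V) : Digraph V where
  Adj v w := G.Adj v w ∧ v ≠ w

/-- The set `S(G, H) = H(G, H) ∩ H(G*, H*)` of strict homomorphisms. -/
def strictHoms {V W : Type u} (G : Digraph V) (H : Digraph W) : Set (V → W) :=
  homs G H ∩ homs (loopless G) (loopless H)

/-- `p 0, …, p n` is a directed walk of length `n`. -/
def IsWalk {V : Type u} (G : Digraph V) {n : ℕ} (p : Fin (n + 1) → V) : Prop :=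
  ∀ i : Fin n, G.Adj (p i.castSucc) (p i.succ)

/-- A path is a walk whose vertices are distinct. -/
def IsPath {V : Type u} (G : Digraph V) {n : ℕ} (p : Fin (n + 1) → V) : Prop :=
  IsWalk G p ∧ Function.Injective p

/-- No closed walk of length at least one. -/
def IsAcyclic {V : Type u} (G : Digraph V) : Prop :=
  ∀ (n : ℕ) (p : Fin (n + 1) → V), 1 ≤ n → IsWalk G p → p 0 ≠ p (Fin.last n)

/-- A class of digraphs. -/
abbrev DigraphClass : Type (u + 1) := (V : Type u) → Digraph V → Prop

/-- The class of digraphs `G` for which `G*` is acyclic. -/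
def Ta : DigraphClass.{u} := fun _ G => IsAcyclic (loopless G)

def IsReflexive {V : Type u} (G : Digraph V) : Prop := ∀ v, G.Adj v v

/-- The class of posets: reflexive, antisymmetric, transitive digraphs. -/
def Poset : DigraphClass.{u} := fun _ G =>
  IsReflexive G ∧ (∀ v w, G.Adj v w → G.Adj w v → v = w) ∧
    ∀ v w x, G.Adj v w → G.Adj w x → G.Adj v x

/-- `#H(G, R) ≤ #H(G, S)` for all finite non-empty `G` in the class `D`. -/
def HomLE (D : DigraphClass.{u}) {VR VS : Type u} (R : Digraph VR) (S : Digraph VS) : Prop :=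
  ∀ (V : Type u) [Finite V] [Nonempty V] (G : Digraph V), D V G →
    (homs G R).ncard ≤ (homs G S).ncard

/-- `#S(G, R) ≤ #S(G, S)` for all finite non-empty `G` in the class `D`. -/
def StrictHomLE (D : DigraphClass.{u}) {VR VS : Type u} (R : Digraph VR) (S : Digraph VS) :
    Prop :=
  ∀ (V : Type u) [Finite V] [Nonempty V] (G : Digraph V), D V G →
    (strictHoms G R).ncard ≤ (strictHoms G S).ncard

/-- The height of a (finite, non-empty) digraph: the largest length of a path. -/
noncomputable def height {V : Type u} (G : Digraph V) : ℕ :=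
  sSup {n | ∃ p : Fin (n + 1) → V, IsPath G p}

/-- The vertex sets of the paths whose length is the height of `G`. -/
def longestPaths {V : Type u} (G : Digraph V) : Set (Set V) :=
  {P | ∃ p : Fin (height G + 1) → V, IsPath G p ∧ Set.range p = P}

/-- The digraph induced on a set of vertices. -/
def induced {V : Type u} (G : Digraph V) (X : Set V) : Digraph X where
  Adj v w := G.Adj v w

/-- The transitive reduction of a digraph in `Ta`, with loops removed: the proper arcs `vw` for
which `G*` has no walk of length at least two from `v` to `w`. -/
def reduction {V : Type u} (G : Digraph V) : Digraph V where
  Adj v w := G.Adj v w ∧ v ≠ w ∧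
    ¬ ∃ (n : ℕ) (p : Fin (n + 1) → V),
      2 ≤ n ∧ IsWalk (loopless G) p ∧ p 0 = v ∧ p (Fin.last n) = w

/-- `ι(v, w)`, the number of vertices in the interval `[v, w]`. -/
noncomputable def iota {V : Type u} (G : Digraph V) (v w : V) : ℕ :=
  {x | G.Adj v x ∧ G.Adj x w}.ncard

/-- `μ_ξ(L)`: the sum of `ι(ξ v, ξ w)` over the proper arcs `vw` of `L`. -/
noncomputable def mu {V W : Type u} (L : Digraph V) (H : Digraph W) (ξ : V → W) : ℕ :=
  ∑ᶠ e ∈ {e : V × V | (loopless L).Adj e.1 e.2}, iota H (ξ e.1) (ξ e.2)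

/-- `M(L, H)`: the homomorphisms `ξ` for which `μ_ξ(L)` is maximal. -/
def maxHoms {V W : Type u} (L : Digraph V) (H : Digraph W) : Set (V → W) :=
  {ξ | ξ ∈ homs L H ∧ ∀ ζ ∈ homs L H, mu L H ζ ≤ mu L H ξ}

/-- The homomorphisms from `G` to `H` whose restriction to every path `P` of length `height G`
has maximal `μ` among all homomorphisms from the reduction of the digraph induced on `P`. -/
def pathMaxHoms {V W : Type u} (G : Digraph V) (H : Digraph W) : Set (V → W) :=
  {ξ | ξ ∈ homs G H ∧
    ∀ P ∈ longestPaths G, (fun x : P => ξ x) ∈ maxHoms (reduction (induced G P)) H}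

/-- The class of reflexive digraphs `R` in `Ta` admitting a strict homomorphism `R → R` that
is `μ`-maximal on all paths of length `height R`. -/
def ClassR : DigraphClass.{u} := fun V R =>
  Ta V R ∧ IsReflexive R ∧ (pathMaxHoms R R ∩ strictHoms R R).Nonempty

/-- The class of digraphs in `Ta` of height `n` in which every vertex belongs to a path of
length `n`. -/
def TaPure (n : ℕ) : DigraphClass.{u} := fun V G =>
  Ta V G ∧ height G = n ∧
    ∀ v, ∃ p : Fin (n + 1) → V, IsPath G p ∧ v ∈ Set.range p

end HomCount

/-! Strict homomorphisms are singled out by inflating `G`. Insert `k` new vertices into each of the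
selected arcs `a j → b j`. A strict `ξ : G → R` extends in at least `2 ^ k` ways per arc, since each
new vertex may go to either of two distinct end points (`strictHoms_mul_le`). A homomorphism `ξ : G
→ S` extends in at most `(∏ j, iota S (ξ (a j)) (ξ (b j))) ^ k` ways (`homs_le_sum`). If this
product is at most `M = 2 ^ |J|`, and less than `M` for non-strict `ξ`, then `r * M ^ k ≤ s * M ^ k
+ C * (M - 1) ^ k` for all `k`, where `r` and `s` count the strict homomorphisms, so `r ≤ s`.

In (a) the selected arcs are those of the longest paths. Maximality in `ClassR` bounds the interval
sizes along a path by 2 on average (`ClassR.sum_iota_le`), hence also their geometric mean. Purity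
forces a non-strict map to collapse a selected arc, which makes the bound strict.

In (b) all intervals have at most two elements, so all proper arcs can be selected. Conversely,
homomorphisms are sorted by the arcs they collapse and become strict on the contracted digraph.
Passing to transitive closures reduces both directions to posets. -/

namespace HomCount

/-! ### Walks, acyclicity and height -/

section Walks

variable {V : Type u} {W : Type u}

/-- There is a walk of length `n` from `v` to `w`. -/
def Reach (G : Digraph V) : ℕ → V → V → Prop
  | 0, v, w => v = w
  | n + 1, v, w => ∃ x, G.Adj v x ∧ Reach G n x w

theorem Reach.append {G : Digraph V} {m n : ℕ} {u v w : V} (h : Reach G m u v)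
    (h' : Reach G n v w) : Reach G (m + n) u w := by
  induction m generalizing u with
  | zero => cases h; simpa using h'
  | succ m ih =>
    obtain ⟨x, hx, hm⟩ := h
    rw [Nat.add_right_comm]
    exact ⟨x, hx, ih hm⟩

theorem reach_one {G : Digraph V} {v w : V} (h : G.Adj v w) : Reach G 1 v w := ⟨w, h, rfl⟩

theorem IsWalk.reach {G : Digraph V} {n : ℕ} {p : Fin (n + 1) → V} (hp : IsWalk G p)
    (i d : ℕ) (h : i + d < n + 1) : Reach G d (p ⟨i, by omega⟩) (p ⟨i + d, h⟩) := by
  induction d generalizing i with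
  | zero => rfl
  | succ d ih =>
    refine ⟨p ⟨i + 1, by omega⟩, hp ⟨i, by omega⟩, ?_⟩
    have := ih (i + 1) (by omega)
    convert this using 3
    omega

theorem IsWalk.reach_of_le {G : Digraph V} {n : ℕ} {p : Fin (n + 1) → V} (hp : IsWalk G p)
    {i j : Fin (n + 1)} (h : i ≤ j) : Reach G (j - i) (p i) (p j) := by
  have := hp.reach i (j - i) (by omega)
  convert this using 2
  ext
  simp only
  omega

theorem exists_isWalk_of_reach {G : Digraph V} {n : ℕ} {v w : V} (h : Reach G n v w) :
    ∃ p : Fin (n + 1) → V, IsWalk G p ∧ p 0 = v ∧ p (Fin.last n) = w := by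
  induction n generalizing v with
  | zero => exact ⟨fun _ => v, fun i => i.elim0, rfl, h⟩
  | succ n ih =>
    obtain ⟨x, hx, hr⟩ := h
    obtain ⟨p, hp, h0, hl⟩ := ih hr
    refine ⟨Fin.cons v p, fun i => ?_, rfl, by simpa [← Fin.succ_last] using hl⟩
    refine Fin.cases ?_ (fun i => ?_) i
    · simpa [h0] using hx
    · simpa [← Fin.succ_castSucc] using hp i

theorem IsAcyclic.eq_zero_of_reach {G : Digraph V} (hG : IsAcyclic G) {n : ℕ} {v : V}
    (h : Reach G n v v) : n = 0 := by
  by_contra hn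
  obtain ⟨p, hp, h0, hl⟩ := exists_isWalk_of_reach h
  exact hG n p (by omega) hp (h0.trans hl.symm)

theorem IsAcyclic.injective {G : Digraph V} (hG : IsAcyclic G) {n : ℕ} {p : Fin (n + 1) → V}
    (hp : IsWalk G p) : Function.Injective p := by
  have key : ∀ i j, i ≤ j → p i = p j → i = j := by
    intro i j hij h
    have hr := hp.reach_of_le hij
    rw [h] at hr
    have := hG.eq_zero_of_reach hr
    omega
  intro i j h
  rcases le_total i j with hij | hij
  · exact key i j hij h
  · exact (key j i hij h.symm).symm

theorem isAcyclic_of_map {G : Digraph V} {W : Type*} (r : W → W → Prop) (f : V → W)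
    (hirr : ∀ x, ¬ r x x) (htr : ∀ x y z, r x y → r y z → r x z)
    (hf : ∀ v w, G.Adj v w → r (f v) (f w)) : IsAcyclic G := by
  have key : ∀ n v w, Reach G (n + 1) v w → r (f v) (f w) := by
    intro n
    induction n with
    | zero => rintro v w ⟨x, hx, rfl⟩; exact hf _ _ hx
    | succ n ih => rintro v w ⟨x, hx, h⟩; exact htr _ _ _ (hf _ _ hx) (ih _ _ h)
  intro n p hn hp h
  obtain ⟨m, rfl⟩ : ∃ m, n = m + 1 := ⟨n - 1, by omega⟩
  have := hp.reach_of_le (Fin.zero_le (Fin.last (m + 1)))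
  rw [h] at this
  exact hirr _ (key _ _ _ this)

theorem IsPath.isWalk_loopless {G : Digraph V} {n : ℕ} {p : Fin (n + 1) → V} (hp : IsPath G p) :
    IsWalk (loopless G) p :=
  fun i => ⟨hp.1 i, fun h => (Fin.castSucc_lt_succ (i := i)).ne (hp.2 h)⟩

theorem bddAbove_path_lengths [Finite V] (G : Digraph V) :
    BddAbove {n | ∃ p : Fin (n + 1) → V, IsPath G p} := by
  refine ⟨Nat.card V, ?_⟩
  rintro n ⟨p, hp⟩
  have := Nat.card_le_card_of_injective p hp.2
  rw [Nat.card_fin] at this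
  omega

theorem exists_isPath_height [Finite V] [Nonempty V] (G : Digraph V) :
    ∃ p : Fin (height G + 1) → V, IsPath G p :=
  Nat.sSup_mem (s := {n | ∃ p : Fin (n + 1) → V, IsPath G p})
    ⟨0, fun _ => Classical.arbitrary V, fun i => i.elim0,
      fun _ _ _ => Subsingleton.elim (α := Fin 1) _ _⟩ (bddAbove_path_lengths G)

/-- Walks in an acyclic digraph repeat no vertex, so they are paths. Later contradictions arise by
concatenating walks beyond the height. -/
theorem Ta.le_height_of_reach [Finite V] {G : Digraph V} (hG : Ta V G) {n : ℕ} {v w : V}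
    (h : Reach (loopless G) n v w) : n ≤ height G := by
  obtain ⟨p, hp, -, -⟩ := exists_isWalk_of_reach h
  exact le_csSup (bddAbove_path_lengths G) ⟨p, fun i => (hp i).1, IsAcyclic.injective hG hp⟩

theorem isWalk_comp {G : Digraph V} {H : Digraph W} {ξ : V → W} (hξ : ξ ∈ homs G H) {n : ℕ}
    {p : Fin (n + 1) → V} (hp : IsWalk G p) : IsWalk H (ξ ∘ p) :=
  fun i => hξ _ _ (hp i)

end Walks

/-! ### Sizes of intervals -/

section Intervals

variable {V : Type u}

theorem one_le_iota [Finite V] {G : Digraph V} (hG : IsReflexive G) {v w : V} (h : G.Adj v w) :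
    1 ≤ iota G v w :=
  (Set.ncard_pos (Set.toFinite _)).2 ⟨v, hG v, h⟩

theorem Ta.antisymm {G : Digraph V} (hG : Ta V G) {v w : V} (h : G.Adj v w) (h' : G.Adj w v) :
    v = w := by
  by_contra hne
  have := IsAcyclic.eq_zero_of_reach hG
    ((reach_one (G := loopless G) ⟨h, hne⟩).append (reach_one ⟨h', Ne.symm hne⟩))
  omega

theorem Ta.iota_self {G : Digraph V} (hG : Ta V G) (hr : IsReflexive G) (v : V) :
    iota G v v = 1 := by
  rw [iota, Set.ncard_eq_one]
  refine ⟨v, Set.ext fun x => ⟨fun hx => (hG.antisymm hx.1 hx.2).symm, ?_⟩⟩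
  rintro rfl
  exact ⟨hr _, hr _⟩

/-- An arc that lies on a longest path has a trivial interval. -/
theorem Ta.iota_eq_two [Finite V] {G : Digraph V} (hG : Ta V G) (hr : IsReflexive G)
    {p : Fin (height G + 1) → V} (hp : IsWalk (loopless G) p) (i : Fin (height G)) :
    iota G (p i.castSucc) (p i.succ) = 2 := by
  rw [iota, Set.ncard_eq_two]
  refine ⟨p i.castSucc, p i.succ, (hp i).2, Set.ext fun x => ⟨fun hx => ?_, ?_⟩⟩
  · by_contra hne
    simp only [Set.mem_insert_iff, Set.mem_singleton_iff, not_or] at hne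
    -- A third element of the interval would lengthen the path to `height G + 1`.
    have := hG.le_height_of_reach
      (((hp.reach_of_le (Fin.zero_le i.castSucc)).append
        (reach_one (G := loopless G) ⟨hx.1, Ne.symm hne.1⟩)).append
        ((reach_one (G := loopless G) ⟨hx.2, hne.2⟩).append (hp.reach_of_le (Fin.le_last i.succ))))
    simp at this
    omega
  · rintro (rfl | rfl)
    · exact ⟨hr _, (hp i).1⟩
    · exact ⟨(hp i).1, hr _⟩

theorem Ta.iota_le_two_of_height_le_one [Finite V] {G : Digraph V} (hG : Ta V G)
    (hh : height G ≤ 1) (v w : V) : iota G v w ≤ 2 := by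
  refine (Set.ncard_le_ncard (t := {v, w}) (fun x hx => ?_) (Set.toFinite _)).trans
    ((Set.ncard_insert_le v {w}).trans (by rw [Set.ncard_singleton]))
  by_contra hne
  simp only [Set.mem_insert_iff, Set.mem_singleton_iff, not_or] at hne
  have := hG.le_height_of_reach
    ((reach_one (G := loopless G) ⟨hx.1, Ne.symm hne.1⟩).append (reach_one ⟨hx.2, hne.2⟩))
  omega

end Intervals

/-! ### Transitive reductions of paths and the average interval size -/

section Reduction

variable {V : Type u} {W : Type u}

theorem IsWalk.lt_of_adj {G : Digraph V} (hG : Ta V G) {n : ℕ} {p : Fin (n + 1) → V}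
    (hp : IsWalk (loopless G) p) {i j : Fin (n + 1)} (h : (loopless G).Adj (p i) (p j)) :
    i < j := by
  by_contra hij
  have := IsAcyclic.eq_zero_of_reach hG ((reach_one h).append (hp.reach_of_le (not_lt.1 hij)))
  omega

theorem IsWalk.add_le_of_reach {G : Digraph V} (hG : Ta V G) {n : ℕ} {p : Fin (n + 1) → V}
    (hp : IsWalk (loopless G) p) (hs : Function.Surjective p) {m : ℕ} {i j : Fin (n + 1)}
    (h : Reach (loopless G) m (p i) (p j)) : (i : ℕ) + m ≤ j := by
  induction m generalizing i with
  | zero => exact (congrArg Fin.val (IsAcyclic.injective hG hp h)).le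
  | succ m ih =>
    obtain ⟨x, hx, hr⟩ := h
    obtain ⟨l, rfl⟩ := hs x
    have := hp.lt_of_adj hG hx
    have := ih hr
    omega

/-- The transitive reduction of a digraph traversed by a path consists of the arcs of the path. -/
theorem reduction_adj_iff {G : Digraph V} (hG : Ta V G) {n : ℕ} {p : Fin (n + 1) → V}
    (hp : IsWalk (loopless G) p) (hs : Function.Surjective p) (v w : V) :
    (reduction G).Adj v w ↔ ∃ i : Fin n, p i.castSucc = v ∧ p i.succ = w := by
  constructor
  · rintro ⟨h, hne, hno⟩
    obtain ⟨i, rfl⟩ := hs v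
    obtain ⟨j, rfl⟩ := hs w
    have hij := hp.lt_of_adj hG ⟨h, hne⟩
    have hj : (j : ℕ) = i + 1 := by
      by_contra hj
      obtain ⟨q, hq⟩ := exists_isWalk_of_reach (hp.reach_of_le hij.le)
      exact hno ⟨_, q, by omega, hq⟩
    refine ⟨⟨i, by omega⟩, rfl, congrArg p (Fin.ext ?_)⟩
    simp [hj]
  · rintro ⟨i, rfl, rfl⟩
    refine ⟨(hp i).1, (hp i).2, ?_⟩
    rintro ⟨m, q, hm, hq, h0, hl⟩
    have hr := hq.reach_of_le (Fin.zero_le (Fin.last m))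
    rw [h0, hl] at hr
    have := hp.add_le_of_reach hG hs hr
    simp at this
    omega

theorem mu_reduction {G : Digraph V} (hG : Ta V G) {n : ℕ} {p : Fin (n + 1) → V}
    (hp : IsWalk (loopless G) p) (hs : Function.Surjective p) (H : Digraph W) (ξ : V → W) :
    mu (reduction G) H ξ = ∑ i : Fin n, iota H (ξ (p i.castSucc)) (ξ (p i.succ)) := by
  have hset : {e : V × V | (loopless (reduction G)).Adj e.1 e.2} =
      Set.range fun i : Fin n => (p i.castSucc, p i.succ) := by
    ext ⟨v, w⟩
    constructor
    · rintro ⟨h, -⟩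
      obtain ⟨i, rfl, rfl⟩ := (reduction_adj_iff hG hp hs v w).1 h
      exact ⟨i, rfl⟩
    · rintro ⟨i, hi⟩
      cases hi
      exact ⟨(reduction_adj_iff hG hp hs _ _).2 ⟨i, rfl, rfl⟩, (hp i).2⟩
  rw [mu, hset, finsum_mem_range, finsum_eq_sum_of_fintype]
  intro i j h
  exact Fin.castSucc_injective _ (IsAcyclic.injective hG hp (Prod.ext_iff.1 h).1)

theorem Ta.induced {G : Digraph V} (hG : Ta V G) (X : Set V) : Ta X (induced G X) := by
  intro n p hn hp h
  exact hG n (fun i => (p i : V)) hn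
    (fun i => ⟨(hp i).1, fun h => (hp i).2 (Subtype.ext h)⟩) (congrArg Subtype.val h)

/-- In a digraph of `ClassR`, the intervals along a walk as long as the height of the digraph have
at most two vertices on average. -/
theorem ClassR.sum_iota_le [Finite V] [Nonempty V] {R : Digraph V} (hR : ClassR V R)
    {q : Fin (height R + 1) → V} (hq : IsWalk R q) :
    ∑ i : Fin (height R), iota R (q i.castSucc) (q i.succ) ≤ 2 * height R := by
  obtain ⟨hT, hr, ρ, hρ, hρs⟩ := hR
  obtain ⟨p, hp⟩ := exists_isPath_height R
  let e := Equiv.ofInjective p hp.2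
  have hwalk : IsWalk (loopless (HomCount.induced R (Set.range p))) e := fun i =>
    ⟨hp.1 i, fun h => (Fin.castSucc_lt_succ (i := i)).ne (e.injective h)⟩
  have hT' := hT.induced (Set.range p)
  have hhom : q ∘ e.symm ∈ homs (reduction (HomCount.induced R (Set.range p))) R := by
    intro v w h
    obtain ⟨i, rfl, rfl⟩ := (reduction_adj_iff hT' hwalk e.surjective v w).1 h
    simpa using hq i
  -- The walk `q`, transported to the vertices of a longest path `p`, competes with `ρ`. Being
  -- strict, `ρ` sends `p` to a longest path, whose intervals all have size 2.
  have hmax := (hρ.2 _ ⟨p, hp, rfl⟩).2 _ hhom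
  rw [mu_reduction hT' hwalk e.surjective, mu_reduction hT' hwalk e.surjective] at hmax
  simp only [Function.comp_apply, Equiv.symm_apply_apply] at hmax
  refine hmax.trans (le_of_eq ?_)
  have h2 : ∀ i : Fin (height R), iota R (ρ (e i.castSucc)) (ρ (e i.succ)) = 2 :=
    hT.iota_eq_two hr (isWalk_comp hρs.2 hp.isWalk_loopless)
  simp only [h2]
  simp [mul_comm]

end Reduction

/-! ### Counting extensions and comparing growth rates -/

section Counting

/-- The inequality `m ≤ 2 ^ (m - 1)` replaces the comparison of arithmetic and geometric means. -/
theorem prod_le_two_pow {J : Type*} [Fintype J] {f : J → ℕ} (h1 : ∀ j, 1 ≤ f j)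
    (hsum : ∑ j, f j ≤ 2 * Fintype.card J) : ∏ j, f j ≤ ∏ j, 2 ^ (f j - 1) ∧
      ∏ j, 2 ^ (f j - 1) ≤ 2 ^ Fintype.card J := by
  constructor
  · refine Finset.prod_le_prod' fun j _ => ?_
    have := Nat.lt_two_pow_self (n := f j - 1)
    have := h1 j
    omega
  · rw [Finset.prod_pow_eq_pow_sum]
    refine Nat.pow_le_pow_right two_pos ?_
    have h : ∑ j, f j = ∑ j, (f j - 1) + Fintype.card J := by
      rw [Fintype.card, Finset.card_eq_sum_ones, ← Finset.sum_add_distrib]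
      exact Finset.sum_congr rfl fun j _ => (Nat.sub_add_cancel (h1 j)).symm
    omega

theorem prod_lt_two_pow_of_le_two {J : Type*} [Fintype J] {f : J → ℕ} (h1 : ∀ j, 1 ≤ f j)
    (h2 : ∀ j, f j ≤ 2) {j₀ : J} (hj : f j₀ = 1) : ∏ j, f j < 2 ^ Fintype.card J := by
  rw [Fintype.card, ← Finset.prod_const]
  exact Finset.prod_lt_prod (fun j _ => h1 j) (fun j _ => h2 j)
    ⟨j₀, Finset.mem_univ _, by omega⟩

/-- If all factors are at most 2, the factor 1 causes the loss. Otherwise some factor `m ≥ 3` does,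
because then `m < 2 ^ (m - 1)`. -/
theorem prod_lt_two_pow {J : Type*} [Fintype J] {f : J → ℕ} (h1 : ∀ j, 1 ≤ f j)
    (hsum : ∑ j, f j ≤ 2 * Fintype.card J) {j₀ : J} (hj : f j₀ = 1) :
    ∏ j, f j < 2 ^ Fintype.card J := by
  by_cases h2 : ∀ j, f j ≤ 2
  · exact prod_lt_two_pow_of_le_two h1 h2 hj
  · push Not at h2
    obtain ⟨i, hi⟩ := h2
    refine lt_of_lt_of_le (Finset.prod_lt_prod (fun j _ => h1 j) (fun j _ => ?_)
      ⟨i, Finset.mem_univ _, ?_⟩) (prod_le_two_pow h1 hsum).2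
    · have := Nat.lt_two_pow_self (n := f j - 1)
      have := h1 j
      omega
    · obtain ⟨m, hm⟩ : ∃ m, f i = m + 3 := ⟨f i - 3, by omega⟩
      have := Nat.lt_two_pow_self (n := m + 1)
      rw [hm, show m + 3 - 1 = m + 1 + 1 by omega, pow_succ]
      omega

theorem le_of_forall_mul_pow_le {r s C M : ℕ} (hM : 1 ≤ M)
    (h : ∀ k : ℕ, r * M ^ k ≤ s * M ^ k + C * (M - 1) ^ k) : r ≤ s := by
  by_contra! hlt
  have hM' : (0 : ℝ) < M := by exact_mod_cast hM
  have hk : ∃ k : ℕ, (((M - 1 : ℕ) : ℝ) / M) ^ k < 1 / (C + 1) :=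
    exists_pow_lt_of_lt_one (by positivity)
      ((div_lt_one hM').2 (by exact_mod_cast Nat.sub_lt hM one_pos))
  obtain ⟨k, hk⟩ := hk
  rw [div_pow, div_lt_div_iff₀ (by positivity) (by positivity)] at hk
  have hk' : (M - 1) ^ k * (C + 1) < 1 * M ^ k := by exact_mod_cast hk
  have h1 := h k
  have h2 : (s + 1) * M ^ k ≤ r * M ^ k := Nat.mul_le_mul_right _ hlt
  nlinarith [Nat.zero_le ((M - 1) ^ k)]

variable {V VR VS J : Type u}

/-- The interpretation in `V` of `V` together with vertices inserted into the arcs `a j → b j`,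
each of them being identified with one of the end points of its arc. -/
def collapse {k : ℕ} (a b : J → V) (f : J × Fin k → Bool) : V ⊕ J × Fin k → V :=
  Sum.elim id fun x => if f x then a x.1 else b x.1

/-- Each pair `(ξ, f)` yields `ξ ∘ collapse a b f`; reflexivity of `R` absorbs collapsed arcs. The
values on `V` recover `ξ`, and strictness gives `ξ (a j) ≠ ξ (b j)`, which recovers `f`. -/
theorem strictHoms_mul_le [Finite V] [Finite VR] [Fintype J] {G : Digraph V} {R : Digraph VR}
    (hR : IsReflexive R) {a b : J → V} (hab : ∀ j, (loopless G).Adj (a j) (b j)) {k : ℕ}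
    {E : Digraph (V ⊕ J × Fin k)}
    (hE : ∀ f s t, E.Adj s t →
      collapse a b f s = collapse a b f t ∨ G.Adj (collapse a b f s) (collapse a b f t)) :
    (strictHoms G R).ncard * (2 ^ Fintype.card J) ^ k ≤ (homs E R).ncard := by
  have hcard : Nat.card (strictHoms G R × (J × Fin k → Bool)) =
      (strictHoms G R).ncard * (2 ^ Fintype.card J) ^ k := by
    rw [Nat.card_prod, Nat.card_coe_set_eq, Nat.card_fun]
    simp [pow_mul, Nat.card_eq_fintype_card]
  rw [← hcard, ← Nat.card_coe_set_eq]
  refine Nat.card_le_card_of_injective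
    (fun x => ⟨fun s => x.1.1 (collapse a b x.2 s), fun s t hst => ?_⟩) ?_
  · rcases hE x.2 s t hst with h | h
    · simp only [h]
      exact hR _
    · exact x.1.2.1 _ _ h
  · rintro ⟨ξ, f⟩ ⟨ζ, g⟩ h
    have h' : ∀ s, ξ.1 (collapse a b f s) = ζ.1 (collapse a b g s) :=
      fun s => congrFun (congrArg Subtype.val h) s
    have hξ : ξ = ζ := Subtype.ext (funext fun v => h' (Sum.inl v))
    subst hξ
    refine Prod.ext rfl (funext fun x => ?_)
    have hx := h' (Sum.inr x)
    have hne := (ξ.2.2 _ _ (hab x.1)).2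
    simp only [collapse, Sum.elim_inr] at hx
    cases hf : f x <;> cases hg : g x <;> simp_all

theorem homs_le_sum [Finite V] [Finite VS] [Fintype J] {G : Digraph V} {S : Digraph VS}
    [Fintype (homs G S)] {a b : J → V} {k : ℕ} {E : Digraph (V ⊕ J × Fin k)}
    (hG : ∀ v w, G.Adj v w → E.Adj (Sum.inl v) (Sum.inl w))
    (ha : ∀ x : J × Fin k, E.Adj (Sum.inl (a x.1)) (Sum.inr x))
    (hb : ∀ x : J × Fin k, E.Adj (Sum.inr x) (Sum.inl (b x.1))) :
    (homs E S).ncard ≤ ∑ ξ : homs G S, (∏ j, iota S (ξ.1 (a j)) (ξ.1 (b j))) ^ k := by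
  have hcard : Nat.card (Σ ξ : homs G S, ∀ x : J × Fin k,
      {y | S.Adj (ξ.1 (a x.1)) y ∧ S.Adj y (ξ.1 (b x.1))}) =
      ∑ ξ : homs G S, (∏ j, iota S (ξ.1 (a j)) (ξ.1 (b j))) ^ k := by
    rw [Nat.card_sigma]
    refine Finset.sum_congr rfl fun ξ _ => ?_
    rw [Nat.card_pi, Fintype.prod_prod_type, ← Finset.prod_pow]
    simp [iota, Nat.card_coe_set_eq]
  rw [← hcard, ← Nat.card_coe_set_eq]
  refine Nat.card_le_card_of_injective
    (fun η => ⟨⟨fun v => η.1 (Sum.inl v), fun v w h => η.2 _ _ (hG v w h)⟩,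
      fun x => ⟨η.1 (Sum.inr x), η.2 _ _ (ha x), η.2 _ _ (hb x)⟩⟩) ?_
  intro η θ h
  have h' := congrArg (fun y : Σ ξ : homs G S, ∀ x : J × Fin k,
    {y | S.Adj (ξ.1 (a x.1)) y ∧ S.Adj y (ξ.1 (b x.1))} =>
      (Sum.elim y.1.1 fun x => (y.2 x).1 : V ⊕ J × Fin k → VS)) h
  refine Subtype.ext (funext fun s => ?_)
  have hs := congrFun h' s
  rcases s with v | x <;> exact hs

/-- Insert `k` vertices into each of the arcs `a j → b j` of `G`, for every `k`. If the intervals of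
these arcs are, for non-strict homomorphisms to `S`, smaller on geometric average than for strict
homomorphisms, then the strict homomorphisms dominate the count for large `k`. -/
theorem strictHoms_ncard_le_of_extensions [Finite V] [Finite VR] [Finite VS] [Fintype J]
    {G : Digraph V} {R : Digraph VR} {S : Digraph VS} (hR : IsReflexive R) {a b : J → V}
    (hab : ∀ j, (loopless G).Adj (a j) (b j)) (E : ∀ k, Digraph (V ⊕ J × Fin k))
    (hE : ∀ k f s t, (E k).Adj s t →
      collapse a b f s = collapse a b f t ∨ G.Adj (collapse a b f s) (collapse a b f t))
    (hG : ∀ k v w, G.Adj v w → (E k).Adj (Sum.inl v) (Sum.inl w))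
    (ha : ∀ k (x : J × Fin k), (E k).Adj (Sum.inl (a x.1)) (Sum.inr x))
    (hb : ∀ k (x : J × Fin k), (E k).Adj (Sum.inr x) (Sum.inl (b x.1)))
    (hle : ∀ ξ ∈ homs G S, ∏ j, iota S (ξ (a j)) (ξ (b j)) ≤ 2 ^ Fintype.card J)
    (hlt : ∀ ξ ∈ homs G S, ξ ∉ strictHoms G S →
      ∏ j, iota S (ξ (a j)) (ξ (b j)) < 2 ^ Fintype.card J)
    (hRS : ∀ k, (homs (E k) R).ncard ≤ (homs (E k) S).ncard) :
    (strictHoms G R).ncard ≤ (strictHoms G S).ncard := by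
  classical
  have := Fintype.ofFinite (homs G S)
  refine le_of_forall_mul_pow_le (C := Nat.card (homs G S)) (M := 2 ^ Fintype.card J)
    Nat.one_le_two_pow fun k => ?_
  refine (strictHoms_mul_le hR hab (hE k)).trans ((hRS k).trans
    ((homs_le_sum (hG k) (ha k) (hb k)).trans ?_))
  -- The error term `(M - 1) ^ k` is granted to strict maps as well, so that it sums to `C * (M - 1)
  -- ^ k` with `C` the number of all homomorphisms.
  have hbound : ∀ ξ : homs G S, (∏ j, iota S (ξ.1 (a j)) (ξ.1 (b j))) ^ k ≤
      (if ξ.1 ∈ strictHoms G S then (2 ^ Fintype.card J) ^ k else 0) +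
        (2 ^ Fintype.card J - 1) ^ k := by
    intro ξ
    split_ifs with h
    · exact (Nat.pow_le_pow_left (hle _ ξ.2) k).trans (Nat.le_add_right _ _)
    · rw [zero_add]
      exact Nat.pow_le_pow_left (Nat.le_sub_one_of_lt (hlt _ ξ.2 h)) k
  refine (Finset.sum_le_sum fun ξ _ => hbound ξ).trans (le_of_eq ?_)
  rw [Finset.sum_add_distrib, ← Finset.sum_filter, Finset.sum_const, Finset.sum_const]
  simp only [smul_eq_mul, Finset.card_univ, Nat.card_eq_fintype_card]
  congr 2
  rw [← Nat.card_coe_set_eq, ← Fintype.card_subtype, ← Nat.card_eq_fintype_card]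
  exact Nat.card_congr (Equiv.subtypeSubtypeEquivSubtype fun h => h.1)

end Counting

/-! ### The two inflated digraphs -/

section Insertion

variable {V J : Type u}

/-- Insert `k` vertices into each of the arcs `a j → b j`. -/
def insertion (G : Digraph V) (a b : J → V) (k : ℕ) : Digraph (V ⊕ J × Fin k) where
  Adj
    | Sum.inl v, Sum.inl w => G.Adj v w
    | Sum.inl v, Sum.inr x => v = a x.1
    | Sum.inr x, Sum.inl w => b x.1 = w
    | Sum.inr _, Sum.inr _ => False

/-- Insert `k` vertices into each of the intervals `[a j, b j]` of a poset, as freely as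
possible. -/
def posetInsertion (G : Digraph V) (a b : J → V) (k : ℕ) : Digraph (V ⊕ J × Fin k) where
  Adj
    | Sum.inl v, Sum.inl w => G.Adj v w
    | Sum.inl v, Sum.inr x => G.Adj v (a x.1)
    | Sum.inr x, Sum.inl w => G.Adj (b x.1) w
    | Sum.inr x, Sum.inr y => x = y ∨ G.Adj (b x.1) (a y.1)

theorem insertion_collapse {G : Digraph V} {a b : J → V}
    (hab : ∀ j, (loopless G).Adj (a j) (b j)) (k : ℕ) (f : J × Fin k → Bool)
    (s t : V ⊕ J × Fin k) (h : (insertion G a b k).Adj s t) :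
    collapse a b f s = collapse a b f t ∨ G.Adj (collapse a b f s) (collapse a b f t) := by
  rcases s with v | x <;> rcases t with w | y <;> simp only [insertion] at h <;>
    simp only [collapse, Sum.elim_inl, Sum.elim_inr, id]
  · exact Or.inr h
  · subst h
    split_ifs
    · exact Or.inl rfl
    · exact Or.inr (hab _).1
  · subst h
    split_ifs
    · exact Or.inr (hab _).1
    · exact Or.inl rfl

theorem posetInsertion_collapse {G : Digraph V} (hG : Poset V G) {a b : J → V}
    (hab : ∀ j, (loopless G).Adj (a j) (b j)) (k : ℕ) (f : J × Fin k → Bool)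
    (s t : V ⊕ J × Fin k) (h : (posetInsertion G a b k).Adj s t) :
    collapse a b f s = collapse a b f t ∨ G.Adj (collapse a b f s) (collapse a b f t) := by
  obtain ⟨hr, -, htr⟩ := hG
  have hlow : ∀ x : J × Fin k, G.Adj (a x.1) (if f x then a x.1 else b x.1) := by
    intro x
    split_ifs
    · exact hr _
    · exact (hab _).1
  have hupp : ∀ x : J × Fin k, G.Adj (if f x then a x.1 else b x.1) (b x.1) := by
    intro x
    split_ifs
    · exact (hab _).1
    · exact hr _
  rcases s with v | x <;> rcases t with w | y <;> simp only [posetInsertion] at h <;>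
    simp only [collapse, Sum.elim_inl, Sum.elim_inr, id]
  · exact Or.inr h
  · exact Or.inr (htr _ _ _ h (hlow y))
  · exact Or.inr (htr _ _ _ (hupp x) h)
  · rcases h with rfl | h
    · exact Or.inl rfl
    · exact Or.inr (htr _ _ _ (hupp x) (htr _ _ _ h (hlow y)))

theorem posetInsertion_poset {G : Digraph V} (hG : Poset V G) {a b : J → V}
    (hab : ∀ j, (loopless G).Adj (a j) (b j)) (k : ℕ) : Poset _ (posetInsertion G a b k) := by
  obtain ⟨hr, hanti, htr⟩ := hG
  have hno : ∀ j, ¬ G.Adj (b j) (a j) := fun j h => (hab j).2 (hanti _ _ (hab j).1 h)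
  refine ⟨?_, ?_, ?_⟩
  · rintro (v | x)
    · exact hr v
    · exact Or.inl rfl
  · rintro (v | x) (w | y) h h' <;> simp only [posetInsertion] at h h'
    · rw [hanti _ _ h h']
    · exact (hno _ (htr _ _ _ h' h)).elim
    · exact (hno _ (htr _ _ _ h h')).elim
    · rcases h with rfl | h
      · rfl
      · rcases h' with rfl | h'
        · rfl
        · exact (hno _ (htr _ _ _ h (htr _ _ _ (hab y.1).1 h'))).elim
  · rintro (u | x) (v | y) (w | z) h h' <;> simp only [posetInsertion] at h h' ⊢
    · exact htr _ _ _ h h'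
    · exact htr _ _ _ h h'
    · exact htr _ _ _ h (htr _ _ _ (hab y.1).1 h')
    · rcases h' with rfl | h'
      · exact h
      · exact htr _ _ _ h (htr _ _ _ (hab y.1).1 h')
    · exact htr _ _ _ h h'
    · exact Or.inr (htr _ _ _ h h')
    · rcases h with rfl | h
      · exact h'
      · exact htr _ _ _ h (htr _ _ _ (hab y.1).1 h')
    · rcases h with rfl | h
      · exact h'
      · rcases h' with rfl | h'
        · exact Or.inr h
        · exact Or.inr (htr _ _ _ h (htr _ _ _ (hab y.1).1 h'))

theorem Ta.insertion {G : Digraph V} (hG : Ta V G) {a b : J → V}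
    (hab : ∀ j, (loopless G).Adj (a j) (b j)) (k : ℕ) : Ta _ (insertion G a b k) := by
  have hirr : ∀ v, ¬ Relation.TransGen (loopless G).Adj v v := by
    have key : ∀ v w, Relation.TransGen (loopless G).Adj v w →
        ∃ n, Reach (loopless G) (n + 1) v w := by
      intro v w h
      induction h with
      | single h => exact ⟨0, reach_one h⟩
      | tail _ h ih =>
        obtain ⟨n, hn⟩ := ih
        exact ⟨n + 1, hn.append (reach_one h)⟩
    intro v h
    obtain ⟨n, hn⟩ := key v v h
    have := IsAcyclic.eq_zero_of_reach hG hn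
    omega
  -- Lexicographic ranking: the vertices inserted into `a j → b j` are placed just after `a j`.
  refine isAcyclic_of_map (Prod.Lex (Relation.TransGen (loopless G).Adj) (· < ·))
    (Sum.elim (fun v => (v, (0 : ℕ))) fun x => (a x.1, 1)) ?_ ?_ ?_
  · rintro ⟨v, i⟩ h
    rcases Prod.lex_def.1 h with h | ⟨-, h⟩
    · exact hirr _ h
    · exact lt_irrefl _ h
  · rintro ⟨u, i⟩ ⟨v, j⟩ ⟨w, l⟩ h h'
    rw [Prod.lex_def] at h h' ⊢
    simp only at h h' ⊢
    rcases h with h | ⟨rfl, h⟩ <;> rcases h' with h' | ⟨rfl, h'⟩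
    · exact Or.inl (h.trans h')
    · exact Or.inl h
    · exact Or.inl h'
    · exact Or.inr ⟨rfl, h.trans h'⟩
  · rintro (v | x) (w | y) ⟨h, hne⟩ <;> simp only [HomCount.insertion] at h <;>
      simp only [Sum.elim_inl, Sum.elim_inr, Prod.lex_def]
    · exact Or.inl (.single ⟨h, fun h => hne (congrArg _ h)⟩)
    · exact Or.inr ⟨h, one_pos⟩
    · subst h
      exact Or.inl (.single (hab _))

end Insertion

/-! ### Digraphs covered by longest paths -/

section Pure

variable {V VR VS : Type u}

/-- A homomorphism that does not collapse an arc of a longest path is strict. -/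
theorem TaPure.mem_strictHoms [Finite V] [Finite VS] {n : ℕ} {G : Digraph V} (hG : TaPure n V G)
    {S : Digraph VS} (hS : Ta VS S) (hn : height S = n) {ξ : V → VS} (hξ : ξ ∈ homs G S)
    (h : ∀ p : Fin (n + 1) → V, IsPath G p → ∀ i : Fin n, ξ (p i.castSucc) ≠ ξ (p i.succ)) :
    ξ ∈ strictHoms G S := by
  obtain ⟨hT, hh, hcov⟩ := hG
  have hwalk : ∀ p : Fin (n + 1) → V, IsPath G p → IsWalk (loopless S) (ξ ∘ p) :=
    fun p hp i => ⟨hξ _ _ (hp.1 i), h p hp i⟩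
  refine ⟨hξ, fun v w hvw => ⟨hξ _ _ hvw.1, fun heq => ?_⟩⟩
  obtain ⟨p, hp, i, rfl⟩ := hcov v
  obtain ⟨q, hq, j, rfl⟩ := hcov w
  -- In `G`, following `p` up to `v`, the arc `vw`, then `q` onwards gives `i + 1 + (n - j) ≤ n`. In
  -- `S`, where `v` and `w` have the same image, following `q` up to it and then `p` gives `j + (n -
  -- i) ≤ n`. These are incompatible.
  have h1 := hT.le_height_of_reach
    (((hp.isWalk_loopless.reach_of_le (Fin.zero_le i)).append (reach_one hvw)).append
      (hq.isWalk_loopless.reach_of_le (Fin.le_last j)))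
  have h2 := (hwalk q hq).reach_of_le (Fin.zero_le j)
  have h3 := (hwalk p hp).reach_of_le (Fin.le_last i)
  simp only [Function.comp_apply] at h2 h3
  rw [← heq] at h2
  have h4 := hS.le_height_of_reach (h2.append h3)
  simp at h1 h4
  omega

theorem TaPure.strictHoms_ncard_le [Finite V] [Finite VR] [Finite VS] [Nonempty VS] {n : ℕ}
    {G : Digraph V} (hG : TaPure n V G) {R : Digraph VR} {S : Digraph VS} (hR : IsReflexive R)
    (hS : ClassR VS S) (hn : height S = n)
    (hle : (∀ (J : Type u) [Finite J] (a b : J → V), (∀ j, (loopless G).Adj (a j) (b j)) →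
        ∀ k, (homs (insertion G a b k) R).ncard ≤ (homs (insertion G a b k) S).ncard) ∨
      (Poset V G ∧ ∀ (J : Type u) [Finite J] (a b : J → V),
        (∀ j, (loopless G).Adj (a j) (b j)) → ∀ k,
          (homs (posetInsertion G a b k) R).ncard ≤ (homs (posetInsertion G a b k) S).ncard)) :
    (strictHoms G R).ncard ≤ (strictHoms G S).ncard := by
  classical
  -- An arc is counted once for each longest path through it, so that sums over `J` split path by
  -- path.
  let J := {p : Fin (n + 1) → V // IsPath G p} × Fin n
  have : Fintype {p : Fin (n + 1) → V // IsPath G p} := Fintype.ofFinite _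
  let a : J → V := fun j => j.1.1 j.2.castSucc
  let b : J → V := fun j => j.1.1 j.2.succ
  have hab : ∀ j, (loopless G).Adj (a j) (b j) := fun j => j.1.2.isWalk_loopless j.2
  have h1 : ∀ ξ ∈ homs G S, ∀ j, 1 ≤ iota S (ξ (a j)) (ξ (b j)) := fun ξ hξ j =>
    one_le_iota hS.2.1 (hξ _ _ (hab j).1)
  have hsum : ∀ ξ ∈ homs G S, ∑ j, iota S (ξ (a j)) (ξ (b j)) ≤ 2 * Fintype.card J := by
    intro ξ hξ
    rw [Fintype.sum_prod_type, Fintype.card_prod, Fintype.card_fin, mul_left_comm, ← smul_eq_mul,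
      Fintype.card, ← Finset.sum_const]
    refine Finset.sum_le_sum fun p _ => ?_
    subst hn
    exact hS.sum_iota_le (isWalk_comp hξ p.2.1)
  have hprod : ∀ ξ ∈ homs G S, ∏ j, iota S (ξ (a j)) (ξ (b j)) ≤ 2 ^ Fintype.card J :=
    fun ξ hξ => (prod_le_two_pow (h1 ξ hξ) (hsum ξ hξ)).1.trans
      (prod_le_two_pow (h1 ξ hξ) (hsum ξ hξ)).2
  have hlt : ∀ ξ ∈ homs G S, ξ ∉ strictHoms G S →
      ∏ j, iota S (ξ (a j)) (ξ (b j)) < 2 ^ Fintype.card J := by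
    intro ξ hξ hns
    obtain ⟨p, hp, i, hi⟩ : ∃ p : Fin (n + 1) → V, ∃ _ : IsPath G p, ∃ i : Fin n,
        ξ (p i.castSucc) = ξ (p i.succ) := by
      by_contra! hno
      exact hns (hG.mem_strictHoms hS.1 hn hξ hno)
    refine prod_lt_two_pow (h1 ξ hξ) (hsum ξ hξ) (j₀ := (⟨p, hp⟩, i)) ?_
    change iota S (ξ (p i.castSucc)) (ξ (p i.succ)) = 1
    rw [hi, hS.1.iota_self hS.2.1]
  rcases hle with hle | ⟨hP, hle⟩
  · exact strictHoms_ncard_le_of_extensions hR hab (insertion G a b) (insertion_collapse hab)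
      (fun _ _ _ h => h) (fun _ _ => rfl) (fun _ _ => rfl) hprod hlt (hle J a b hab)
  · exact strictHoms_ncard_le_of_extensions hR hab (posetInsertion G a b)
      (posetInsertion_collapse hP hab) (fun _ _ _ h => h) (fun _ _ => hP.1 _) (fun _ _ => hP.1 _)
      hprod hlt (hle J a b hab)

end Pure

/-! ### Posets, transitive closure and contraction -/

section Posets

variable {V VR VS : Type u}

theorem Poset.ta {G : Digraph V} (hG : Poset V G) : Ta V G := by
  refine isAcyclic_of_map (loopless G).Adj id (fun x h => h.2 rfl) (fun x y z h h' => ?_)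
    fun _ _ h => h
  refine ⟨hG.2.2 _ _ _ h.1 h'.1, ?_⟩
  rintro rfl
  exact h.2 (hG.2.1 _ _ h.1 h'.1)

/-- The reflexive transitive closure of a digraph. -/
def transClosure (G : Digraph V) : Digraph V where
  Adj := Relation.ReflTransGen G.Adj

/-- In a poset a composite of proper arcs is a proper arc, so strictness passes along walks. -/
theorem strictHoms_transClosure (G : Digraph V) {R : Digraph VR} (hR : Poset VR R) :
    strictHoms (transClosure G) R = strictHoms G R := by
  obtain ⟨hr, hanti, htr⟩ := hR
  ext ξ
  constructor
  · rintro ⟨h, h'⟩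
    exact ⟨fun v w hvw => h _ _ (.single hvw), fun v w hvw => h' _ _ ⟨.single hvw.1, hvw.2⟩⟩
  · rintro ⟨h, h'⟩
    have key : ∀ v w, Relation.ReflTransGen G.Adj v w → v = w ∨ (loopless R).Adj (ξ v) (ξ w) := by
      intro v w hvw
      induction hvw with
      | refl => exact Or.inl rfl
      | @tail x w _ hxw ih =>
        by_cases hne : x = w
        · exact hne ▸ ih
        · have hstep := h' _ _ ⟨hxw, hne⟩
          rcases ih with rfl | ih
          · exact Or.inr hstep
          · refine Or.inr ⟨htr _ _ _ ih.1 hstep.1, fun heq => hstep.2 ?_⟩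
            exact hanti _ _ hstep.1 (heq ▸ ih.1)
    refine ⟨fun v w hvw => ?_, fun v w hvw => (key v w hvw.1).resolve_left hvw.2⟩
    rcases key v w hvw with rfl | h
    · exact hr _
    · exact h.1

theorem poset_transClosure {G : Digraph V} {R : Digraph VR} (hR : Poset VR R)
    (h : (strictHoms G R).Nonempty) : Poset V (transClosure G) := by
  rw [← strictHoms_transClosure G hR] at h
  obtain ⟨ξ, hξ, hξ'⟩ := h
  refine ⟨fun v => .refl, fun v w hvw hwv => ?_, fun v w x h h' => Relation.ReflTransGen.trans h h'⟩
  by_contra hne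
  exact (hξ' v w ⟨hvw, hne⟩).2 (hR.2.1 _ _ (hξ _ _ hvw) (hξ _ _ hwv))

/-- The digraph `G` may be arbitrary: either it has no strict map to `R`, or its closure is a poset
with the same strict maps. -/
theorem HomLE.strictHoms_ncard_le_of_height_le_one [Finite V] [Nonempty V] [Finite VR] [Finite VS]
    {R : Digraph VR} {S : Digraph VS} (h : HomLE Poset R S) (hR : Poset VR R) (hS : Poset VS S)
    (hh : height S ≤ 1) (G : Digraph V) :
    (strictHoms G R).ncard ≤ (strictHoms G S).ncard := by
  classical
  rcases Set.eq_empty_or_nonempty (strictHoms G R) with he | hne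
  · simp [he]
  have hP := poset_transClosure hR hne
  rw [← strictHoms_transClosure G hR, ← strictHoms_transClosure G hS]
  generalize transClosure G = H at hP
  let J := {e : V × V // (loopless H).Adj e.1 e.2}
  have : Fintype J := Fintype.ofFinite _
  have hab : ∀ j : J, (loopless H).Adj j.1.1 j.1.2 := fun j => j.2
  have h2 : ∀ v w, iota S v w ≤ 2 := hS.ta.iota_le_two_of_height_le_one hh
  refine strictHoms_ncard_le_of_extensions hR.1 hab (posetInsertion H _ _)
    (posetInsertion_collapse hP hab) (fun _ _ _ h => h) (fun _ _ => hP.1 _) (fun _ _ => hP.1 _)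
    (fun ξ _ => Finset.prod_le_pow_card _ _ _ fun j _ => h2 _ _) (fun ξ hξ hns => ?_)
    fun k => h _ _ (posetInsertion_poset hP hab k)
  obtain ⟨v, w, hvw, heq⟩ : ∃ v w, ∃ _ : (loopless H).Adj v w, ξ v = ξ w := by
    by_contra! hno
    exact hns ⟨hξ, fun v w hvw => ⟨hξ _ _ hvw.1, hno v w hvw⟩⟩
  refine prod_lt_two_pow_of_le_two (fun j => one_le_iota hS.1 (hξ _ _ j.2.1)) (fun j => h2 _ _)
    (j₀ := ⟨(v, w), hvw⟩) ?_
  simp only [heq]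
  exact hS.ta.iota_self hS.1 _

/-- The arcs of `G` that are collapsed by a map. -/
def collapsedArcs (G : Digraph V) {W : Type u} (ξ : V → W) : Set (V × V) :=
  {e | G.Adj e.1 e.2 ∧ ξ e.1 = ξ e.2}

/-- The digraph obtained from `G` by contracting the pairs in `B`. -/
def contraction (G : Digraph V) (B : Set (V × V)) :
    Digraph (Quot fun v w => (v, w) ∈ B) where
  Adj x y := ∃ v w, Quot.mk _ v = x ∧ Quot.mk _ w = y ∧ G.Adj v w

theorem homs_eq_sum_collapsedArcs [Finite V] [Finite VR] [Fintype (Set (V × V))] (G : Digraph V)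
    (R : Digraph VR) : (homs G R).ncard =
      ∑ B : Set (V × V), Nat.card {ξ : homs G R // collapsedArcs G ξ.1 = B} := by
  rw [← Nat.card_sigma, ← Nat.card_coe_set_eq]
  exact Nat.card_congr (Equiv.sigmaFiberEquiv fun ξ : homs G R => collapsedArcs G ξ.1).symm

/-- For each set `B` of collapsed arcs, the maps to `R` collapsing exactly `B` factor injectively
through strict maps on the contraction. If such a map exists, strict maps from the contraction to
`S` pull back to maps collapsing exactly `B`. -/
theorem StrictHomLE.homs_ncard_le [Finite V] [Nonempty V] [Finite VR] [Finite VS]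
    {R : Digraph VR} {S : Digraph VS} (h : StrictHomLE Poset R S) (hR : Poset VR R)
    (hS : Poset VS S) (G : Digraph V) : (homs G R).ncard ≤ (homs G S).ncard := by
  classical
  have := Fintype.ofFinite (Set (V × V))
  rw [homs_eq_sum_collapsedArcs, homs_eq_sum_collapsedArcs]
  refine Finset.sum_le_sum fun B _ => ?_
  rcases isEmpty_or_nonempty {ξ : homs G R // collapsedArcs G ξ.1 = B} with he | ⟨⟨ξ₀, hξ₀⟩⟩
  · simp
  let lift : {ξ : homs G R // collapsedArcs G ξ.1 = B} → Quot (fun v w => (v, w) ∈ B) → VR :=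
    fun ξ => Quot.lift ξ.1.1 fun v w hvw => (ξ.2.symm ▸ hvw : (v, w) ∈ collapsedArcs G ξ.1.1).2
  have hlift : ∀ ξ, lift ξ ∈ strictHoms (contraction G B) R := by
    intro ξ
    constructor
    · rintro _ _ ⟨v, w, rfl, rfl, hvw⟩
      exact ξ.1.2 _ _ hvw
    · rintro _ _ ⟨⟨v, w, rfl, rfl, hvw⟩, hne⟩
      refine ⟨ξ.1.2 _ _ hvw, fun heq => hne (Quot.sound ?_)⟩
      rw [← ξ.2]
      exact ⟨hvw, heq⟩
  have hP := poset_transClosure hR ⟨_, hlift ⟨ξ₀, hξ₀⟩⟩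
  have hfin : Finite (Quot fun v w => (v, w) ∈ B) := Quot.finite _
  have hnonempty : Nonempty (Quot fun v w => (v, w) ∈ B) := Nonempty.map (Quot.mk _) ‹_›
  have hle := h _ _ hP
  rw [strictHoms_transClosure _ hR, strictHoms_transClosure _ hS, ← Nat.card_coe_set_eq,
    ← Nat.card_coe_set_eq] at hle
  refine (Nat.card_le_card_of_injective (fun ξ => (⟨lift ξ, hlift ξ⟩ :
    strictHoms (contraction G B) R)) fun ξ ζ heq => ?_).trans (hle.trans ?_)
  · refine Subtype.ext (Subtype.ext (funext fun v => ?_))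
    exact congrFun (congrArg Subtype.val heq) (Quot.mk _ v)
  · refine Nat.card_le_card_of_injective (fun η => ⟨⟨fun v => η.1 (Quot.mk _ v),
      fun v w hvw => η.2.1 _ _ ⟨v, w, rfl, rfl, hvw⟩⟩, ?_⟩) fun η θ heq => ?_
    · ext ⟨v, w⟩
      constructor
      · rintro ⟨hvw, heq⟩
        by_contra hB
        -- A strict `η` collapses `vw` only if `v` and `w` lie in one class; then `ξ₀` collapses
        -- `vw` too, so the arc is in `B`.
        refine (η.2.2 (Quot.mk _ v) (Quot.mk _ w) ⟨⟨v, w, rfl, rfl, hvw⟩, fun hq => hB ?_⟩).2 heq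
        rw [← hξ₀]
        exact ⟨hvw, congrArg (lift ⟨ξ₀, hξ₀⟩) hq⟩
      · intro hB
        refine ⟨?_, congrArg η.1 (Quot.sound hB)⟩
        rw [← hξ₀] at hB
        exact hB.1
    · refine Subtype.ext (funext fun x => ?_)
      induction x using Quot.ind with
      | mk v => exact congrFun (congrArg (fun ξ => ξ.1.1) heq) v

end Posets

end HomCount

theorem theorem6 {VR VS : Type u} [Finite VR] [Nonempty VR] [Finite VS] [Nonempty VS]
    (R : Digraph VR) (S : Digraph VS) :
    (∀ n : ℕ, 1 ≤ n → HomCount.ClassR VR R → HomCount.ClassR VS S →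
      HomCount.height R = n → HomCount.height S = n →
      (HomCount.HomLE HomCount.Ta R S →
        ∀ (V : Type u) [Finite V] [Nonempty V] (G : Digraph V), HomCount.TaPure n V G →
          (HomCount.strictHoms G S).Nonempty →
          (HomCount.strictHoms G R).ncard ≤ (HomCount.strictHoms G S).ncard) ∧
      (HomCount.HomLE HomCount.Poset R S →
        ∀ (V : Type u) [Finite V] [Nonempty V] (G : Digraph V), HomCount.TaPure n V G →
          HomCount.Poset V G →
          (HomCount.strictHoms G R).ncard ≤ (HomCount.strictHoms G S).ncard)) ∧
    (HomCount.Poset VR R → HomCount.Poset VS S →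
      HomCount.height R = HomCount.height S → HomCount.height R ≤ 1 →
      (HomCount.HomLE HomCount.Ta R S ↔ HomCount.StrictHomLE HomCount.Ta R S) ∧
      (HomCount.HomLE HomCount.Poset R S ↔ HomCount.StrictHomLE HomCount.Poset R S)) := by
  constructor
  · intro n _ hR hS _ hn
    refine ⟨fun h V _ _ G hG _ => ?_, fun h V _ _ G hG hP => ?_⟩
    · exact hG.strictHoms_ncard_le hR.2.1 hS hn
        (Or.inl fun J _ a b hab k => h _ _ (hG.1.insertion hab k))
    · exact hG.strictHoms_ncard_le hR.2.1 hS hn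
        (Or.inr ⟨hP, fun J _ a b hab k => h _ _ (HomCount.posetInsertion_poset hP hab k)⟩)
  · intro hR hS hh hle
    rw [hh] at hle
    -- Posets lie in `Ta`, and the comparison on posets already settles all digraphs `G`, so both
    -- domains are covered.
    refine ⟨⟨fun h V _ _ G _ => ?_, fun h V _ _ G _ => ?_⟩,
      ⟨fun h V _ _ G _ => ?_, fun h V _ _ G _ => ?_⟩⟩
    · exact HomCount.HomLE.strictHoms_ncard_le_of_height_le_one
        (fun W _ _ H hH => h W H hH.ta) hR hS hle G
    · exact HomCount.StrictHomLE.homs_ncard_le (fun W _ _ H hH => h W H hH.ta) hR hS G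
    · exact h.strictHoms_ncard_le_of_height_le_one hR hS hle G
    · exact h.homs_ncard_le hR hS G
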